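/- Let $k$ be an algebraically closed field of characteristic $0$. A potential is a quasi-homogeneous polynomial $f \in k[x_1,\dots,x_n]$, for some grading $|x_i| \in \mathbb{Q}_{>0}$ of the variables, such that the Jacobian ring $k[x_1,\dots,x_n]/(\partial_{x_1} f,\dots,\partial_{x_n} f)$ is nonzero and finite-dimensional over $k$. Given potentials $f \in k[x_1,\dots,x_m]$ and $g \in k[y_1,\dots,y_n]$, a (graded) matrix factorization $Q$ of $f-g$ is a finitely generated free $\mathbb{Q}$-graded module $Q = Q_+\oplus Q_-$ over $T = k[x_1,\dots,x_m,y_1,\dots,y_n]$ (a finite direct sum of shifts $T(q)$, $q\in\mathbb{Q}$, split into an even and an odd part), together with an odd quasi-homogeneous endomorphism $d_Q$ such that $d_Q^2 = (f-g)\cdot\mathrm{id}_Q$. Writing $\partial Q$ for the entrywise derivative of the matrix of $d_Q$ in a homogeneous basis, the left quantum dimension of $Q$ is the multivariate residue $$\mathrm{res}\left(\frac{\mathrm{str}\big(\partial_{x_1}Q\cdots\partial_{x_m}Q\,\partial_{y_1}Q\cdots\partial_{y_n}Q\big)\,dx_1\wedge\cdots\wedge dx_m}{\partial_{x_1}f,\dots,\partial_{x_m}f}\right),$$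 taken over the base ring $k[y_1,\dots,y_n]$, and the right quantum dimension is the residue of the same supertrace with respect to $dy_1\wedge\cdots\wedge dy_n$ and $\partial_{y_1}g,\dots,\partial_{y_n}g$, over the base ring $k[x_1,\dots,x_m]$. The potentials $f$ and $g$ are called orbifold equivalent if there is a matrix factorization of $f-g$ whose left and right quantum dimensions are both nonzero. **Proposition.** The polynomials $$f_{Q_{12}} = u^5+v^3+uw^2, \qquad f_{E_{18}} = x^5z+y^3+z^2,$$ which describe the bimodal singularities $Q_{12}$ and $E_{18}$, are potentials for the grading $|u|=\tfrac25$, $|v|=\tfrac23$, $|w|=\tfrac45$, $|x|=\tfrac15$, $|y|=\tfrac23$, $|z|=1$, and they are orbifold equivalent. Moreover, there is a matrix factorization of $f_{Q_{12}}-f_{E_{18}}$ of rank $8$ (over $k[u,v,w,x,y,z]$) whose left and right quantum dimensions are both nonzero. -/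

import Mathlib

open MvPolynomial

noncomputable section

namespace LandauGinzburg

/-! ### Potentials -/

/-- The Jacobian ideal `(∂f/∂x₁, …, ∂f/∂xₙ)`. -/
def jacobianIdeal {k : Type*} [Field k] {n : ℕ} (f : MvPolynomial (Fin n) k) :
    Ideal (MvPolynomial (Fin n) k) :=
  Ideal.span (Set.range fun i => pderiv i f)

/-- `f` is a potential in `k[x₁, …, xₙ]`, where `xᵢ` has degree `w i`: the degrees are positive,
`f` is quasi-homogeneous, and `k[x] / (∂f/∂x₁, …, ∂f/∂xₙ)` is nonzero and finite-dimensional. -/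
structure IsPotential {k : Type*} [Field k] {n : ℕ} (w : Fin n → ℚ)
    (f : MvPolynomial (Fin n) k) : Prop where
  weight_pos : ∀ i, 0 < w i
  quasiHomogeneous : ∃ d : ℚ, IsWeightedHomogeneous w f d
  nontrivial : Nontrivial (MvPolynomial (Fin n) k ⧸ jacobianIdeal f)
  finiteDimensional : FiniteDimensional k (MvPolynomial (Fin n) k ⧸ jacobianIdeal f)

/-! ### Multivariate residues

The residue symbol `res (g dx₁ ∧ ⋯ ∧ dxₙ / F₁, …, Fₙ)` over a base ring `A`. It is computed by the
transformation rule: if `M F = (x₁ ^ d₁, …, xₙ ^ dₙ)`, then it is the coefficient of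
`x₁ ^ (d₁ - 1) ⋯ xₙ ^ (dₙ - 1)` in `g * det M`. That this does not depend on `M` and `d` is
proved in `residue_eq`. -/

section Residue

variable {A : Type*} [CommRing A] {n : ℕ}

/-- The matrix `M` transforms the sequence `F` into `(x₁ ^ d₁, …, xₙ ^ dₙ)`, with all `dᵢ ≥ 1`. -/
def TransformsToPowers (F : Fin n → MvPolynomial (Fin n) A) (d : Fin n → ℕ)
    (M : Matrix (Fin n) (Fin n) (MvPolynomial (Fin n) A)) : Prop :=
  (∀ i, 0 < d i) ∧ M.mulVec F = fun i => X i ^ d i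

/-- The coefficient of `x₁ ^ (d₁ - 1) ⋯ xₙ ^ (dₙ - 1)` in `g`. -/
def coeffPred (d : Fin n → ℕ) (g : MvPolynomial (Fin n) A) : A :=
  coeff (Finsupp.equivFunOnFinite.symm fun i => d i - 1) g

open Classical in
/-- The residue symbol of `g dx₁ ∧ ⋯ ∧ dxₙ` over `F₁, …, Fₙ`. It is given the value `0` if the ideal
generated by the `Fᵢ` does not contain a power of every variable. -/
def residue (F : Fin n → MvPolynomial (Fin n) A) (g : MvPolynomial (Fin n) A) : A :=
  if h : ∃ p : (Fin n → ℕ) × Matrix (Fin n) (Fin n) (MvPolynomial (Fin n) A),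
      TransformsToPowers F p.1 p.2 then
    coeffPred h.choose.1 (g * h.choose.2.det)
  else 0

theorem coeffPred_sub (d : Fin n → ℕ) (g h : MvPolynomial (Fin n) A) :
    coeffPred d (g - h) = coeffPred d g - coeffPred d h := by
  simp [coeffPred]

/-- If every term of `∑ l, c l * h l` is a multiple of some `x_l ^ (d l)` then its coefficient
vanishes. -/
theorem coeff_sum_eq_zero (m : Fin n →₀ ℕ) (c h : Fin n → MvPolynomial (Fin n) A)
    (hh : ∀ l, h l = 0 ∨ ∃ a, m l < a ∧ h l = X l ^ a) :
    coeff m (∑ l, c l * h l) = 0 := by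
  rw [coeff_sum]
  refine Finset.sum_eq_zero fun l _ => ?_
  rcases hh l with h0 | ⟨a, ha, h0⟩
  · simp [h0]
  · rw [h0, X_pow_eq_monomial, coeff_mul_monomial', if_neg]
    intro hle
    have := hle l
    simp at this
    omega

theorem det_mul_eq (N : Matrix (Fin n) (Fin n) (MvPolynomial (Fin n) A))
    (F h : Fin n → MvPolynomial (Fin n) A) (hN : N.mulVec F = h) (j : Fin n) :
    N.det * F j = ∑ l, N.adjugate j l * h l := by
  have h1 : N.adjugate.mulVec (N.mulVec F) = N.det • F := by
    rw [Matrix.mulVec_mulVec, Matrix.adjugate_mul, Matrix.smul_mulVec, Matrix.one_mulVec]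
  have h2 := congrFun h1 j
  rw [hN] at h2
  simp only [Pi.smul_apply, smul_eq_mul] at h2
  rw [← h2]
  rfl

theorem det_mul_sum_eq (N : Matrix (Fin n) (Fin n) (MvPolynomial (Fin n) A))
    (F h : Fin n → MvPolynomial (Fin n) A) (hN : N.mulVec F = h)
    (c : Fin n → MvPolynomial (Fin n) A) (g : MvPolynomial (Fin n) A) :
    g * N.det * (∑ j, c j * F j) = ∑ l, (g * ∑ j, c j * N.adjugate j l) * h l := by
  have : g * N.det * (∑ j, c j * F j) = g * ∑ j, c j * (N.det * F j) := by
    rw [mul_assoc, Finset.mul_sum]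
    congr 1
    exact Finset.sum_congr rfl fun j _ => by ring
  rw [this]
  simp_rw [det_mul_eq N F h hN, Finset.mul_sum, Finset.sum_mul]
  rw [Finset.sum_comm]
  exact Finset.sum_congr rfl fun l _ => Finset.sum_congr rfl fun j _ => by ring

theorem coeffPred_row_zero (F : Fin n → MvPolynomial (Fin n) A) (d : Fin n → ℕ)
    (hd : ∀ i, 0 < d i) (i : Fin n) (e : ℕ) (c : Fin n → MvPolynomial (Fin n) A)
    (hc : ∑ j, c j * F j = X i ^ e)
    (N : Matrix (Fin n) (Fin n) (MvPolynomial (Fin n) A))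
    (hN : N.mulVec F = fun l => if l = i then 0 else X l ^ d l) (g : MvPolynomial (Fin n) A) :
    coeffPred d (g * N.det) = 0 := by
  have h1 := det_mul_sum_eq N F _ hN c g
  rw [hc] at h1
  have h2 := coeff_mul_monomial (Finsupp.equivFunOnFinite.symm fun i => d i - 1)
    (Finsupp.single i e) (1 : A) (g * N.det)
  rw [mul_one, ← X_pow_eq_monomial, h1] at h2
  rw [coeffPred, ← h2]
  refine coeff_sum_eq_zero _ _ _ fun l => ?_
  by_cases hl : l = i
  · simp [hl]
  · refine Or.inr ⟨d l, ?_, by simp [hl]⟩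
    have := hd l
    simp [Ne.symm hl]
    omega

theorem coeffPred_det_eq (F : Fin n → MvPolynomial (Fin n) A) (d : Fin n → ℕ)
    (M M' : Matrix (Fin n) (Fin n) (MvPolynomial (Fin n) A))
    (hM : TransformsToPowers F d M) (hM' : TransformsToPowers F d M')
    (g : MvPolynomial (Fin n) A) :
    coeffPred d (g * M'.det) = coeffPred d (g * M.det) := by
  classical
  let P : Finset (Fin n) → Matrix (Fin n) (Fin n) (MvPolynomial (Fin n) A) :=
    fun s i => if i ∈ s then M' i else M i
  have hrow : ∀ i, M i ⬝ᵥ F = X i ^ d i := fun i => congrFun hM.2 i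
  have hrow' : ∀ i, M' i ⬝ᵥ F = X i ^ d i := fun i => congrFun hM'.2 i
  have key : ∀ s, coeffPred d (g * (P s).det) = coeffPred d (g * M.det) := by
    intro s
    induction s using Finset.induction_on with
    | empty => simp [P]
    | insert i s his ih =>
      rw [← ih, ← sub_eq_zero, ← coeffPred_sub, ← mul_sub]
      have e1 : P (insert i s) = (P s).updateRow i (P s i + (M' i - M i)) := by
        ext l j : 2
        rw [Matrix.updateRow_apply]
        by_cases hl : l = i
        · subst hl
          simp [P, his]
        · simp [P, hl]
      rw [e1, Matrix.det_updateRow_add, Matrix.updateRow_eq_self, add_sub_cancel_left]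
      refine coeffPred_row_zero F d hM.1 i (d i) (M i) (hrow i) _ ?_ g
      funext l
      by_cases hl : l = i
      · subst hl
        change (P s).updateRow l (M' l - M l) l ⬝ᵥ F = _
        rw [Matrix.updateRow_self, sub_dotProduct, hrow, hrow', sub_self, if_pos rfl]
      · change (P s).updateRow i (M' i - M i) l ⬝ᵥ F = _
        rw [Matrix.updateRow_ne hl, if_neg hl]
        by_cases hs : l ∈ s
        · simp only [P, if_pos hs, hrow']
        · simp only [P, if_neg hs, hrow]
  have := key Finset.univ
  simpa [P] using this

theorem transformsToPowers_diagonal (F : Fin n → MvPolynomial (Fin n) A) (d e : Fin n → ℕ)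
    (M : Matrix (Fin n) (Fin n) (MvPolynomial (Fin n) A)) (hM : TransformsToPowers F d M) :
    TransformsToPowers F (e + d) (Matrix.diagonal (fun i => X i ^ e i) * M) := by
  refine ⟨fun i => Nat.add_pos_right _ (hM.1 i), ?_⟩
  rw [← Matrix.mulVec_mulVec, hM.2]
  funext i
  simp [Matrix.mulVec_diagonal, pow_add]

theorem coeffPred_diagonal (d e : Fin n → ℕ) (hd : ∀ i, 0 < d i)
    (M : Matrix (Fin n) (Fin n) (MvPolynomial (Fin n) A)) (g : MvPolynomial (Fin n) A) :
    coeffPred (e + d) (g * (Matrix.diagonal (fun i => X i ^ e i) * M).det) =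
      coeffPred d (g * M.det) := by
  have h1 : (∏ i, (X i : MvPolynomial (Fin n) A) ^ e i) =
      monomial (Finsupp.equivFunOnFinite.symm e) 1 := by
    rw [monomial_eq, map_one, one_mul, Finsupp.prod_fintype _ _ (by simp)]
    simp
  have h2 : (Finsupp.equivFunOnFinite.symm fun i => (e + d) i - 1) =
      (Finsupp.equivFunOnFinite.symm fun i => d i - 1) + Finsupp.equivFunOnFinite.symm e := by
    ext i
    have := hd i
    simp
    omega
  rw [Matrix.det_mul, Matrix.det_diagonal, h1, mul_left_comm, mul_comm (monomial _ _), coeffPred,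
    h2, coeff_mul_monomial, mul_one, coeffPred]

/-- The residue may be computed with any choice of exponents and transformation matrix. -/
theorem residue_eq (F : Fin n → MvPolynomial (Fin n) A) (d : Fin n → ℕ)
    (M : Matrix (Fin n) (Fin n) (MvPolynomial (Fin n) A)) (hM : TransformsToPowers F d M)
    (g : MvPolynomial (Fin n) A) :
    residue F g = coeffPred d (g * M.det) := by
  have h : ∃ p : (Fin n → ℕ) × Matrix (Fin n) (Fin n) (MvPolynomial (Fin n) A),
      TransformsToPowers F p.1 p.2 := ⟨(d, M), hM⟩
  rw [residue, dif_pos h]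
  have hc := h.choose_spec
  set d' := h.choose.1
  set M' := h.choose.2
  rw [← coeffPred_diagonal d' d hc.1 M' g, ← coeffPred_diagonal d d' hM.1 M g, add_comm d' d]
  refine coeffPred_det_eq F (d + d') _ _ ?_ (transformsToPowers_diagonal F d' d M' hc) g
  rw [add_comm d d']
  exact transformsToPowers_diagonal F d d' M hM

/-- The residue vanishes on the ideal generated by the denominators. -/
theorem residue_eq_zero (F : Fin n → MvPolynomial (Fin n) A) (g : MvPolynomial (Fin n) A)
    (hg : g ∈ Ideal.span (Set.range F)) : residue F g = 0 := by
  rw [residue]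
  split_ifs with h
  · obtain ⟨c, hc⟩ := (Ideal.mem_span_range_iff_exists_fun).1 hg
    have h1 := det_mul_sum_eq _ F _ h.choose_spec.2 c 1
    rw [hc, one_mul, mul_comm] at h1
    rw [h1, coeffPred]
    refine coeff_sum_eq_zero _ _ _ fun l => Or.inr ⟨_, ?_, rfl⟩
    have := h.choose_spec.1 l
    simp
    omega
  · rfl

/-- The residue with respect to powers of the variables is a coefficient. -/
theorem residue_X_pow (d : Fin n → ℕ) (hd : ∀ i, 0 < d i) (g : MvPolynomial (Fin n) A) :
    residue (fun i => X i ^ d i) g = coeffPred d g := by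
  rw [residue_eq _ d 1 ⟨hd, by simp⟩, Matrix.det_one, mul_one]

/-- The transformation rule. -/
theorem residue_mulVec (F : Fin n → MvPolynomial (Fin n) A) (d : Fin n → ℕ)
    (N M : Matrix (Fin n) (Fin n) (MvPolynomial (Fin n) A))
    (hN : TransformsToPowers (M.mulVec F) d N) (g : MvPolynomial (Fin n) A) :
    residue (M.mulVec F) (g * M.det) = residue F g := by
  have hNM : TransformsToPowers F d (N * M) :=
    ⟨hN.1, by rw [← Matrix.mulVec_mulVec]; exact hN.2⟩
  rw [residue_eq _ d N hN, residue_eq F d (N * M) hNM, Matrix.det_mul]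
  congr 1
  ring

end Residue

/-! ### Graded matrix factorizations -/

/-- `D` is the matrix of a quasi-homogeneous map `⨁ⱼ T(a j) → ⨁ᵢ T(b i)` of degree `ℓ`, where
`T = k[xₛ : s ∈ σ]` is graded by `w` and `T(q)` is the shifted module with `T(q)ₘ = T_{q + m}`. -/
def IsGradedMatrix {k σ ι κ : Type*} [Field k] (w : σ → ℚ) (a : ι → ℚ) (b : κ → ℚ) (ℓ : ℚ)
    (D : Matrix κ ι (MvPolynomial σ k)) : Prop :=
  ∀ i j, IsWeightedHomogeneous w (D i j) (b i - a j + ℓ)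

/-- A matrix factorization of `h ∈ T = k[xₛ : s ∈ σ]`: the supergraded, finitely generated, free,
graded `T`-module `X = X₊ ⊕ X₋`, where `X₊ = ⨁ᵢ T(evenShift i)` and `X₋ = ⨁ⱼ T(oddShift j)`,
together with an odd quasi-homogeneous endomorphism `d` such that `d² = h · id`. -/
structure MatrixFactorization {k σ : Type*} [Field k] (w : σ → ℚ) (h : MvPolynomial σ k) where
  evenRank : ℕ
  oddRank : ℕ
  evenShift : Fin evenRank → ℚ
  oddShift : Fin oddRank → ℚ
  /-- The degree of `d`. -/
  degree : ℚ
  d : Matrix (Fin evenRank ⊕ Fin oddRank) (Fin evenRank ⊕ Fin oddRank) (MvPolynomial σ k)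
  odd₁₁ : d.toBlocks₁₁ = 0
  odd₂₂ : d.toBlocks₂₂ = 0
  graded : IsGradedMatrix w (Sum.elim evenShift oddShift) (Sum.elim evenShift oddShift) degree d
  sq : d * d = h • (1 : Matrix _ _ (MvPolynomial σ k))

namespace MatrixFactorization

variable {k σ : Type*} [Field k] {w : σ → ℚ} {h : MvPolynomial σ k}

/-- The rank of the underlying free module `X₊ ⊕ X₋`. -/
def rank (Q : MatrixFactorization w h) : ℕ := Q.evenRank + Q.oddRank

/-- The entrywise partial derivative `∂ₛ Q` of the matrix of `d`. -/
def partialDeriv (Q : MatrixFactorization w h) (s : σ) :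
    Matrix (Fin Q.evenRank ⊕ Fin Q.oddRank) (Fin Q.evenRank ⊕ Fin Q.oddRank) (MvPolynomial σ k) :=
  Q.d.map (pderiv s)

end MatrixFactorization

/-- The supertrace of an endomorphism of `X₊ ⊕ X₋`. -/
def supertrace {T ι κ : Type*} [CommRing T] [Fintype ι] [Fintype κ]
    (D : Matrix (ι ⊕ κ) (ι ⊕ κ) T) : T :=
  D.toBlocks₁₁.trace - D.toBlocks₂₂.trace

section OrbifoldEquivalence

variable {k : Type*} [Field k] {m n : ℕ}

/-- The element `f ⊗ 1 - 1 ⊗ g` of `k[x₁, …, xₘ] ⊗ k[y₁, …, yₙ]`, where the tensor product is the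
polynomial ring in the variables `x₁, …, xₘ` (`Sum.inl`) and `y₁, …, yₙ` (`Sum.inr`). -/
def difference (f : MvPolynomial (Fin m) k) (g : MvPolynomial (Fin n) k) :
    MvPolynomial (Fin m ⊕ Fin n) k :=
  rename Sum.inl f - rename Sum.inr g

/-- A matrix factorization of `f - g`, where `xᵢ` has degree `wf i` and `yⱼ` has degree `wg j`. -/
abbrev Defect (wf : Fin m → ℚ) (wg : Fin n → ℚ) (f : MvPolynomial (Fin m) k)
    (g : MvPolynomial (Fin n) k) :=
  MatrixFactorization (Sum.elim wf wg) (difference f g)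

namespace Defect

variable {wf : Fin m → ℚ} {wg : Fin n → ℚ} {f : MvPolynomial (Fin m) k}
  {g : MvPolynomial (Fin n) k}

/-- `str (∂_{x₁} Q ⋯ ∂_{xₘ} Q ∂_{y₁} Q ⋯ ∂_{yₙ} Q)`. -/
def qdimNumerator (Q : Defect wf wg f g) : MvPolynomial (Fin m ⊕ Fin n) k :=
  supertrace ((List.ofFn fun i : Fin m => Q.partialDeriv (Sum.inl i)).prod *
    (List.ofFn fun j : Fin n => Q.partialDeriv (Sum.inr j)).prod)

/-- The left quantum dimension: the residue of the numerator with respect to `x₁, …, xₘ` and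
`∂_{x₁} f, …, ∂_{xₘ} f`, over the base ring `k[y₁, …, yₙ]`. -/
def leftQdim (Q : Defect wf wg f g) : MvPolynomial (Fin n) k :=
  residue (fun i => map C (pderiv i f)) (sumAlgEquiv k (Fin m) (Fin n) Q.qdimNumerator)

/-- The right quantum dimension: the residue of the numerator with respect to `y₁, …, yₙ` and
`∂_{y₁} g, …, ∂_{yₙ} g`, over the base ring `k[x₁, …, xₘ]`. -/
def rightQdim (Q : Defect wf wg f g) : MvPolynomial (Fin m) k :=
  residue (fun j => map C (pderiv j g))
    (sumAlgEquiv k (Fin n) (Fin m) (rename Sum.swap Q.qdimNumerator))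

end Defect

/-- Two potentials are orbifold equivalent if there is a matrix factorization of their difference
with nonzero left and right quantum dimensions. -/
def OrbifoldEquivalent (wf : Fin m → ℚ) (f : MvPolynomial (Fin m) k) (wg : Fin n → ℚ)
    (g : MvPolynomial (Fin n) k) : Prop :=
  IsPotential wf f ∧ IsPotential wg g ∧
    ∃ Q : Defect wf wg f g, Q.leftQdim ≠ 0 ∧ Q.rightQdim ≠ 0

end OrbifoldEquivalence

/-! ### The two singularities -/

/-- The potential `u⁵ + v³ + u w²` in the variables `u, v, w`. -/
def fQ12 (k : Type*) [Field k] : MvPolynomial (Fin 3) k :=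
  X 0 ^ 5 + X 1 ^ 3 + X 0 * X 2 ^ 2

/-- The degrees of `u, v, w`, for which `u⁵ + v³ + u w²` has degree `2`. -/
def weightQ12 : Fin 3 → ℚ := ![2 / 5, 2 / 3, 4 / 5]

/-- The potential `x⁵ z + y³ + z²` in the variables `x, y, z`. -/
def fE18 (k : Type*) [Field k] : MvPolynomial (Fin 3) k :=
  X 0 ^ 5 * X 2 + X 1 ^ 3 + X 2 ^ 2

/-- The degrees of `x, y, z`, for which `x⁵ z + y³ + z²` has degree `2`. -/
def weightE18 : Fin 3 → ℚ := ![1 / 5, 2 / 3, 1]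

end LandauGinzburg

end

/-! The factorization is a Koszul one, of rank `2 ^ 3`, built from a way of writing the difference
of the potentials as `a₁ b₁ + a₂ b₂ + a₃ b₃`. The cubes split off as `v³ - y³ = (v - y)(v² + v y +
y²)`. In what remains, substitute `u = c² x²`: completing the square in `z` gives `(c x w)² - (z +
x⁵/2)² + (c¹⁰ + 1/4) x¹⁰`. When `c¹⁰ = -1/4` this is a difference of two squares and so a product,
and the error made by the substitution is divisible by `u - c² x²`. This is
`sum_factorsA_mul_factorsB`.

The differential is additive in the pairs `(a, b)`, so its partial derivatives are again of Koszul
type. `supertrace_koszulDifferential` then yields the numerator in closed form, `12 c (v + y)(w² - 5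
(c² u³ x² + c⁴ u² x⁴ + c⁶ u x⁶ + c⁸ x⁸))`.

For the residues, explicit matrices carry the partial derivatives of each potential into powers of
the variables; the same matrices prove that the Jacobian rings are finite-dimensional. By
`residue_ne_zero` it suffices to look at the constant terms of the quantum dimensions. Only `w²`
survives on the left and only `x⁸` on the right, and the constant terms are `-2 c` and `4 c⁹`. -/

noncomputable section

namespace LandauGinzburg

/-! ### Criteria for potentials and for coefficients -/

section Criteria

variable {k : Type*} [Field k]

/-- A quotient of a polynomial ring in which every variable is nilpotent is finite-dimensional. -/
theorem finiteDimensional_quotient_of_pow_mem {n : ℕ} (I : Ideal (MvPolynomial (Fin n) k))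
    (h : ∀ i, ∃ d : ℕ, X i ^ d ∈ I) : FiniteDimensional k (MvPolynomial (Fin n) k ⧸ I) := by
  -- A nilpotent element is a root of a power of the variable, hence integral; an algebra generated
  -- by finitely many integral elements is a finite module.
  have hint : ∀ x ∈ Set.range fun i => Ideal.Quotient.mkₐ k I (X i), IsIntegral k x := by
    rintro _ ⟨i, rfl⟩
    obtain ⟨d, hd⟩ := h i
    refine ⟨Polynomial.X ^ (d + 1), Polynomial.monic_X_pow _, ?_⟩
    rw [Polynomial.eval₂_X_pow, ← map_pow]
    exact Ideal.Quotient.eq_zero_iff_mem.2 (by rw [pow_succ]; exact I.mul_mem_right _ hd)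
  have htop : Algebra.adjoin k (Set.range fun i => Ideal.Quotient.mkₐ k I (X i)) = ⊤ := by
    have := congrArg (Subalgebra.map (Ideal.Quotient.mkₐ k I)) (adjoin_range_X (R := k) (σ := Fin n))
    rw [AlgHom.map_adjoin, ← Set.range_comp, Algebra.map_top,
      (AlgHom.range_eq_top _).2 (Ideal.Quotient.mkₐ_surjective k I)] at this
    exact this
  have hfg := fg_adjoin_of_finite (Set.finite_range _) hint
  rw [htop] at hfg
  exact ⟨by simpa using hfg⟩

/-- The Jacobian ring is nonzero as soon as `0` is a critical point. -/
theorem nontrivial_quotient_jacobianIdeal {n : ℕ} (f : MvPolynomial (Fin n) k)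
    (h : ∀ i, constantCoeff (pderiv i f) = 0) :
    Nontrivial (MvPolynomial (Fin n) k ⧸ jacobianIdeal f) := by
  rw [Ideal.Quotient.nontrivial_iff]
  have hle : jacobianIdeal f ≤ RingHom.ker (constantCoeff (σ := Fin n) (R := k)) := by
    rw [jacobianIdeal, Ideal.span_le]
    rintro _ ⟨i, rfl⟩
    exact h i
  intro htop
  have h1 : (1 : MvPolynomial (Fin n) k) ∈ jacobianIdeal f := htop ▸ Submodule.mem_top
  have h2 := hle h1
  rw [RingHom.mem_ker, map_one] at h2
  exact one_ne_zero h2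

/-- A transformation of the partial derivatives into powers of the variables shows that the
Jacobian ring is finite-dimensional. -/
theorem finiteDimensional_of_transformsToPowers {n : ℕ} (f : MvPolynomial (Fin n) k)
    (d : Fin n → ℕ) (M : Matrix (Fin n) (Fin n) (MvPolynomial (Fin n) k))
    (hM : TransformsToPowers (fun i => pderiv i f) d M) :
    FiniteDimensional k (MvPolynomial (Fin n) k ⧸ jacobianIdeal f) := by
  refine finiteDimensional_quotient_of_pow_mem _ fun i => ⟨d i, ?_⟩
  rw [← congrFun hM.2 i]
  simp only [Matrix.mulVec, dotProduct]
  exact (jacobianIdeal f).sum_mem fun j _ =>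
    (jacobianIdeal f).mul_mem_left _ (Ideal.subset_span (Set.mem_range_self j))

/-- A transformation into powers of the variables may be extended to a larger base ring. -/
theorem TransformsToPowers.map {A B : Type*} [CommRing A] [CommRing B] (φ : A →+* B) {n : ℕ}
    {F : Fin n → MvPolynomial (Fin n) A} {d : Fin n → ℕ}
    {M : Matrix (Fin n) (Fin n) (MvPolynomial (Fin n) A)} (hM : TransformsToPowers F d M) :
    TransformsToPowers (fun i => MvPolynomial.map φ (F i)) d (M.map (MvPolynomial.map φ)) := by
  refine ⟨hM.1, funext fun i => ?_⟩
  have := congrArg (MvPolynomial.map φ) (congrFun hM.2 i)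
  simpa [Matrix.mulVec, dotProduct] using this

/-- Residues over a polynomial base ring, reduced to a coefficient over the field by setting the
parameters to zero. -/
theorem residue_ne_zero {m n : ℕ} (f : MvPolynomial (Fin n) k) (d : Fin n → ℕ)
    (M : Matrix (Fin n) (Fin n) (MvPolynomial (Fin n) k))
    (hM : TransformsToPowers (fun i => pderiv i f) d M)
    (g : MvPolynomial (Fin n) (MvPolynomial (Fin m) k))
    (h : coeffPred d (map constantCoeff g * M.det) ≠ 0) :
    residue (fun i => map (C (σ := Fin m)) (pderiv i f)) g ≠ 0 := by
  rw [residue_eq _ d _ (hM.map C)]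
  intro h0
  apply h
  have h1 := congrArg constantCoeff h0
  rw [coeffPred, ← coeff_map, map_zero] at h1
  -- The entries of `M` do not involve the parameters, so setting these to zero affects only the
  -- numerator.
  have h2 : (map constantCoeff) (M.map (map (C (σ := Fin m)))).det = M.det := by
    rw [RingHom.map_det]
    congr 1
    ext i j : 1
    simp [map_map, MvPolynomial.map_id]
  rwa [map_mul, h2] at h1

theorem coeff_C_mul_X_pow_three (a : k) (i j l i' j' l' : ℕ) :
    coeff (Finsupp.equivFunOnFinite.symm ![i', j', l'])
        (C a * (X 0 ^ i * X 1 ^ j * X 2 ^ l) : MvPolynomial (Fin 3) k) =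
      if i = i' ∧ j = j' ∧ l = l' then a else 0 := by
  have h : (X 0 ^ i * X 1 ^ j * X 2 ^ l : MvPolynomial (Fin 3) k) =
      monomial (Finsupp.equivFunOnFinite.symm ![i, j, l]) 1 := by
    rw [monomial_eq, Finsupp.prod_fintype _ _ (by simp)]
    simp [Fin.prod_univ_three]
  rw [h, C_mul_monomial, mul_one, coeff_monomial]
  refine if_congr ?_ rfl rfl
  rw [Equiv.apply_eq_iff_eq]
  constructor
  · intro h
    exact ⟨congrFun h 0, congrFun h 1, congrFun h 2⟩
  · rintro ⟨rfl, rfl, rfl⟩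
    rfl

end Criteria

/-! ### The two potentials -/

section Potentials

variable (k : Type*) [Field k]

/-- The transformation of the partial derivatives of `u⁵ + v³ + u w²` into `u⁵, v², w³`. -/
def transformQ12 : Matrix (Fin 3) (Fin 3) (MvPolynomial (Fin 3) k) :=
  !![C 5⁻¹ * X 0, 0, -(C 10⁻¹ * X 2); 0, C 3⁻¹, 0; X 2, 0, -(C (5 / 2) * X 0 ^ 3)]

/-- The transformation of the partial derivatives of `x⁵ z + y³ + z²` into `x⁹, y², z²`. -/
def transformE18 : Matrix (Fin 3) (Fin 3) (MvPolynomial (Fin 3) k) :=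
  !![-C (2 / 5), 0, X 0 ^ 4; 0, C 3⁻¹, 0; -(C 10⁻¹ * X 0), 0, C 2⁻¹ * X 2]

theorem pderiv_fQ12 : (fun i => pderiv i (fQ12 k)) =
    ![5 * X 0 ^ 4 + X 2 ^ 2, 3 * X 1 ^ 2, 2 * (X 0 * X 2)] := by
  funext i
  fin_cases i <;> simp [fQ12, pderiv_X] <;> ring

theorem pderiv_fE18 : (fun i => pderiv i (fE18 k)) =
    ![5 * (X 0 ^ 4 * X 2), 3 * X 1 ^ 2, X 0 ^ 5 + 2 * X 2] := by
  funext i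
  fin_cases i <;> simp [fE18, pderiv_X] <;> ring

variable [CharZero k]

/-- With `F₁ = 5u⁴ + w²` and `F₃ = 2uw`, the mixed terms cancel in `(u/5) F₁ - (w/10) F₃ = u⁵` and
in `w F₁ - (5/2) u³ F₃ = w³`. -/
theorem transformsToPowers_fQ12 :
    TransformsToPowers (fun i => pderiv i (fQ12 k)) ![5, 2, 3] (transformQ12 k) := by
  refine ⟨by decide, ?_⟩
  have h1 : (C 5⁻¹ * 5 : MvPolynomial (Fin 3) k) = 1 := by
    rw [← map_ofNat C 5, ← C_mul]; norm_num
  have h2 : (C 10⁻¹ * 2 : MvPolynomial (Fin 3) k) = C 5⁻¹ := by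
    rw [← map_ofNat C 2, ← C_mul]; norm_num
  have h3 : (C 3⁻¹ * 3 : MvPolynomial (Fin 3) k) = 1 := by
    rw [← map_ofNat C 3, ← C_mul]; norm_num
  have h4 : (C (5 / 2) * 2 : MvPolynomial (Fin 3) k) = 5 := by
    rw [← map_ofNat C 2, ← map_ofNat C 5, ← C_mul]; exact congrArg C (by norm_num)
  rw [pderiv_fQ12]
  funext i
  fin_cases i <;> simp only [transformQ12, Matrix.mulVec, dotProduct, Fin.sum_univ_three] <;> simp
  · linear_combination X 0 ^ 5 * h1 - X 0 * X 2 ^ 2 * h2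
  · linear_combination X 1 ^ 2 * h3
  · linear_combination -X 0 ^ 4 * X 2 * h4

/-- With `F₁ = 5x⁴z` and `F₃ = x⁵ + 2z`, one has `x⁴ F₃ - (2/5) F₁ = x⁹` and `(z/2) F₃ - (x/10) F₁ =
z²`. -/
theorem transformsToPowers_fE18 :
    TransformsToPowers (fun i => pderiv i (fE18 k)) ![9, 2, 2] (transformE18 k) := by
  refine ⟨by decide, ?_⟩
  have h1 : (C (2 / 5) * 5 : MvPolynomial (Fin 3) k) = 2 := by
    rw [← map_ofNat C 5, ← map_ofNat C 2, ← C_mul]; exact congrArg C (by norm_num)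
  have h2 : (C 10⁻¹ * 5 : MvPolynomial (Fin 3) k) = C 2⁻¹ := by
    rw [← map_ofNat C 5, ← C_mul]; norm_num
  have h3 : (C 3⁻¹ * 3 : MvPolynomial (Fin 3) k) = 1 := by
    rw [← map_ofNat C 3, ← C_mul]; norm_num
  have h4 : (C 2⁻¹ * 2 : MvPolynomial (Fin 3) k) = 1 := by
    rw [← map_ofNat C 2, ← C_mul]; norm_num
  rw [pderiv_fE18]
  funext i
  fin_cases i <;> simp only [transformE18, Matrix.mulVec, dotProduct, Fin.sum_univ_three] <;> simp
  · linear_combination -X 0 ^ 4 * X 2 * h1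
  · linear_combination X 1 ^ 2 * h3
  · linear_combination -X 0 ^ 5 * X 2 * h2 + X 2 ^ 2 * h4

/-- Change the degree of a quasi-homogeneous polynomial along an equality. -/
theorem isWeightedHomogeneous_of_eq {R σ : Type*} [CommSemiring R] {w : σ → ℚ}
    {p : MvPolynomial σ R} {a b : ℚ} (h : IsWeightedHomogeneous w p a) (hab : a = b) :
    IsWeightedHomogeneous w p b :=
  hab ▸ h

theorem isPotential_fQ12 : IsPotential weightQ12 (fQ12 k) where
  weight_pos := by intro i; fin_cases i <;> norm_num [weightQ12]
  quasiHomogeneous := by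
    have hX := isWeightedHomogeneous_X k weightQ12
    refine ⟨2, ((isWeightedHomogeneous_of_eq ((hX 0).pow 5) ?_).add
      (isWeightedHomogeneous_of_eq ((hX 1).pow 3) ?_)).add
      (isWeightedHomogeneous_of_eq ((hX 0).mul ((hX 2).pow 2)) ?_)⟩ <;> simp [weightQ12] <;> norm_num
  nontrivial := nontrivial_quotient_jacobianIdeal _ fun i => by
    rw [congrFun (pderiv_fQ12 k) i]
    fin_cases i <;> simp
  finiteDimensional := finiteDimensional_of_transformsToPowers _ _ _ (transformsToPowers_fQ12 k)

theorem isPotential_fE18 : IsPotential weightE18 (fE18 k) where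
  weight_pos := by intro i; fin_cases i <;> norm_num [weightE18]
  quasiHomogeneous := by
    have hX := isWeightedHomogeneous_X k weightE18
    refine ⟨2, ((isWeightedHomogeneous_of_eq (((hX 0).pow 5).mul (hX 2)) ?_).add
      (isWeightedHomogeneous_of_eq ((hX 1).pow 3) ?_)).add
      (isWeightedHomogeneous_of_eq ((hX 2).pow 2) ?_)⟩ <;> simp [weightE18] <;> norm_num
  nontrivial := nontrivial_quotient_jacobianIdeal _ fun i => by
    rw [congrFun (pderiv_fE18 k) i]
    fin_cases i <;> simp
  finiteDimensional := finiteDimensional_of_transformsToPowers _ _ _ (transformsToPowers_fE18 k)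

end Potentials

/-! ### Koszul matrix factorizations of `a₁ b₁ + a₂ b₂ + a₃ b₃` -/

section Koszul

variable {T : Type*} [CommRing T]

/-- The component `X₋ → X₊` of the Koszul matrix factorization of `a₁ b₁ + a₂ b₂ + a₃ b₃`. -/
def koszulOddEven (a b : Fin 3 → T) : Matrix (Fin 4) (Fin 4) T :=
  !![a 0, a 1, a 2, 0; -b 1, b 0, 0, a 2; -b 2, 0, b 0, -a 1; 0, -b 2, b 1, a 0]

/-- The component `X₊ → X₋` of the Koszul matrix factorization of `a₁ b₁ + a₂ b₂ + a₃ b₃`. -/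
def koszulEvenOdd (a b : Fin 3 → T) : Matrix (Fin 4) (Fin 4) T :=
  !![b 0, -a 1, -a 2, 0; b 1, a 0, 0, -a 2; b 2, 0, a 0, a 1; 0, b 2, -b 1, b 0]

/-- In the bases `1, e₀₁, e₀₂, e₁₂` and `e₀, e₁, e₂, e₀₁₂` of the exterior algebra, the two blocks
are the components of contraction with `a` plus exterior multiplication by `b`. Each of these
operators squares to zero, and they anticommute up to the scalar `∑ aᵢ bᵢ`. -/
theorem koszulOddEven_mul_koszulEvenOdd (a b : Fin 3 → T) :
    koszulOddEven a b * koszulEvenOdd a b = (∑ i, a i * b i) • 1 := by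
  ext i j
  fin_cases i <;> fin_cases j <;>
    simp [koszulOddEven, koszulEvenOdd, Matrix.mul_apply, Fin.sum_univ_succ] <;> ring

theorem koszulEvenOdd_mul_koszulOddEven (a b : Fin 3 → T) :
    koszulEvenOdd a b * koszulOddEven a b = (∑ i, a i * b i) • 1 := by
  ext i j
  fin_cases i <;> fin_cases j <;>
    simp [koszulOddEven, koszulEvenOdd, Matrix.mul_apply, Fin.sum_univ_succ] <;> ring

/-- The differential of the Koszul matrix factorization of `a₁ b₁ + a₂ b₂ + a₃ b₃`. -/
def koszulDifferential (a b : Fin 3 → T) : Matrix (Fin 4 ⊕ Fin 4) (Fin 4 ⊕ Fin 4) T :=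
  Matrix.fromBlocks 0 (koszulOddEven a b) (koszulEvenOdd a b) 0

theorem koszulDifferential_mul_self (a b : Fin 3 → T) :
    koszulDifferential a b * koszulDifferential a b = (∑ i, a i * b i) • 1 := by
  rw [koszulDifferential, Matrix.fromBlocks_multiply, koszulOddEven_mul_koszulEvenOdd,
    koszulEvenOdd_mul_koszulOddEven, ← Matrix.fromBlocks_one, Matrix.fromBlocks_smul]
  simp

/-- Every entry is zero or, up to sign, a single `aᵢ` or `bᵢ`, so additivity suffices. The case of
interest is a partial derivative, which is not a ring homomorphism. -/
theorem koszulDifferential_map {S : Type*} [CommRing S] (D : T →+ S) (a b : Fin 3 → T) :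
    (koszulDifferential a b).map D = koszulDifferential (fun i => D (a i)) (fun i => D (b i)) := by
  rw [koszulDifferential, Matrix.fromBlocks_map, koszulDifferential]
  congr 1
  · ext; simp
  · ext i j
    fin_cases i <;> fin_cases j <;> simp [koszulOddEven]
  · ext i j
    fin_cases i <;> fin_cases j <;> simp [koszulEvenOdd]
  · ext; simp

/-- The shifts of the even part that make the Koszul differential homogeneous of degree `ℓ`. -/
def koszulEvenShift (α : Fin 3 → ℚ) (ℓ : ℚ) : Fin 4 → ℚ :=
  ![0, 2 * ℓ - α 0 - α 1, 2 * ℓ - α 0 - α 2, 2 * ℓ - α 1 - α 2]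

/-- The shifts of the odd part that make the Koszul differential homogeneous of degree `ℓ`. -/
def koszulOddShift (α : Fin 3 → ℚ) (ℓ : ℚ) : Fin 4 → ℚ :=
  ![ℓ - α 0, ℓ - α 1, ℓ - α 2, 3 * ℓ - α 0 - α 1 - α 2]

/-- The basis vector `e_I` has shift `|I| ℓ - ∑_{i ∈ I} αᵢ`. Removing `i` from `I` then costs degree
`αᵢ`, that of `aᵢ`, and adding it costs `2ℓ - αᵢ`, that of `bᵢ`. -/
theorem isGradedMatrix_koszulDifferential {k σ : Type*} [Field k] {w : σ → ℚ}
    (a b : Fin 3 → MvPolynomial σ k) (α : Fin 3 → ℚ) (ℓ : ℚ)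
    (ha : ∀ i, IsWeightedHomogeneous w (a i) (α i))
    (hb : ∀ i, IsWeightedHomogeneous w (b i) (2 * ℓ - α i)) :
    IsGradedMatrix w (Sum.elim (koszulEvenShift α ℓ) (koszulOddShift α ℓ))
      (Sum.elim (koszulEvenShift α ℓ) (koszulOddShift α ℓ)) ℓ (koszulDifferential a b) := by
  have h0 := isWeightedHomogeneous_zero k w
  have ha' : ∀ (i : Fin 3) (q : ℚ), α i = q → IsWeightedHomogeneous w (a i) q :=
    fun i q h => h ▸ ha i
  have hb' : ∀ (i : Fin 3) (q : ℚ), 2 * ℓ - α i = q → IsWeightedHomogeneous w (b i) q :=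
    fun i q h => h ▸ hb i
  rintro (i | i) (j | j)
  · exact h0 _
  · fin_cases i <;> fin_cases j <;>
      simp [koszulDifferential, koszulOddEven, koszulEvenShift, koszulOddShift, h0] <;>
      first
      | (apply ha'; ring)
      | (apply hb'; ring)
      | (apply IsWeightedHomogeneous.neg; apply ha'; ring)
      | (apply IsWeightedHomogeneous.neg; apply hb'; ring)
  · fin_cases i <;> fin_cases j <;>
      simp [koszulDifferential, koszulEvenOdd, koszulEvenShift, koszulOddShift, h0] <;>
      first
      | (apply ha'; ring)
      | (apply hb'; ring)
      | (apply IsWeightedHomogeneous.neg; apply ha'; ring)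
      | (apply IsWeightedHomogeneous.neg; apply hb'; ring)
  · exact h0 _

/-- The Koszul matrix factorization of `h = a₁ b₁ + a₂ b₂ + a₃ b₃`. -/
def koszulFactorization {k σ : Type*} [Field k] {w : σ → ℚ} {h : MvPolynomial σ k}
    (a b : Fin 3 → MvPolynomial σ k) (α : Fin 3 → ℚ) (ℓ : ℚ)
    (ha : ∀ i, IsWeightedHomogeneous w (a i) (α i))
    (hb : ∀ i, IsWeightedHomogeneous w (b i) (2 * ℓ - α i)) (hab : ∑ i, a i * b i = h) :
    MatrixFactorization w h where
  evenRank := 4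
  oddRank := 4
  evenShift := koszulEvenShift α ℓ
  oddShift := koszulOddShift α ℓ
  degree := ℓ
  d := koszulDifferential a b
  odd₁₁ := Matrix.toBlocks_fromBlocks₁₁ _ _ _ _
  odd₂₂ := Matrix.toBlocks_fromBlocks₂₂ _ _ _ _
  graded := isGradedMatrix_koszulDifferential a b α ℓ ha hb
  sq := hab ▸ koszulDifferential_mul_self a b

end Koszul

/-! ### The factorization of `u⁵ + v³ + u w² - (x⁵ z + y³ + z²)` -/

section Factorization

variable {k : Type*} [Field k]

/-- The factors `u - c² x²`, `c x w - z - x⁵ / 2` and `v - y`. -/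
def factorsA (c : k) : Fin 3 → MvPolynomial (Fin 3 ⊕ Fin 3) k :=
  ![X (Sum.inl 0) - C (c ^ 2) * X (Sum.inr 0) ^ 2,
    C c * (X (Sum.inr 0) * X (Sum.inl 2)) - X (Sum.inr 2) - C 2⁻¹ * X (Sum.inr 0) ^ 5,
    X (Sum.inl 1) - X (Sum.inr 1)]

/-- The complementary factors `w² + (u⁵ - c¹⁰ x¹⁰) / (u - c² x²)`, `c x w + z + x⁵ / 2` and
`v² + v y + y²`. -/
def factorsB (c : k) : Fin 3 → MvPolynomial (Fin 3 ⊕ Fin 3) k :=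
  ![X (Sum.inl 2) ^ 2 + X (Sum.inl 0) ^ 4 + C (c ^ 2) * (X (Sum.inl 0) ^ 3 * X (Sum.inr 0) ^ 2) +
      C (c ^ 4) * (X (Sum.inl 0) ^ 2 * X (Sum.inr 0) ^ 4) + C (c ^ 6) * (X (Sum.inl 0) * X (Sum.inr 0) ^ 6) +
      C (c ^ 8) * X (Sum.inr 0) ^ 8,
    C c * (X (Sum.inr 0) * X (Sum.inl 2)) + X (Sum.inr 2) + C 2⁻¹ * X (Sum.inr 0) ^ 5,
    X (Sum.inl 1) ^ 2 + X (Sum.inl 1) * X (Sum.inr 1) + X (Sum.inr 1) ^ 2]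

theorem sum_factorsA_mul_factorsB [CharZero k] (c : k) (hc : c ^ 10 = -4⁻¹) :
    ∑ i, factorsA c i * factorsB c i = difference (fQ12 k) (fE18 k) := by
  have h2 : (2 * C 2⁻¹ : MvPolynomial (Fin 3 ⊕ Fin 3) k) = 1 := by
    rw [← map_ofNat C 2, ← C_mul]; norm_num
  -- The choice of `c` enters here: the `x¹⁰` left by `u⁵` cancels the one from completing the
  -- square.
  have h10 : (C c ^ 10 : MvPolynomial (Fin 3 ⊕ Fin 3) k) = -C 2⁻¹ ^ 2 := by
    rw [← C_pow, ← C_pow, hc, ← C_neg]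
    exact congrArg C (by norm_num)
  simp only [factorsA, factorsB, difference, fQ12, fE18, Fin.sum_univ_three, map_add, map_mul,
    map_pow, rename_X]
  simp
  linear_combination -X (Sum.inr 0) ^ 10 * h10 - X (Sum.inr 0) ^ 5 * X (Sum.inr 2) * h2

/-- The degrees of the factors `factorsA c`. -/
def degreesA : Fin 3 → ℚ := ![2 / 5, 1, 2 / 3]

theorem isWeightedHomogeneous_factorsA (c : k) (i : Fin 3) :
    IsWeightedHomogeneous (Sum.elim weightQ12 weightE18) (factorsA c i) (degreesA i) := by
  have hX := isWeightedHomogeneous_X k (Sum.elim weightQ12 weightE18)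
  have e := @isWeightedHomogeneous_of_eq k _ _ (Sum.elim weightQ12 weightE18)
  fin_cases i
  · refine (e (hX (Sum.inl 0)) ?_).sub (e (((hX (Sum.inr 0)).pow 2).C_mul _) ?_) <;>
      simp [weightQ12, weightE18, degreesA]
    norm_num
  · refine ((e (((hX (Sum.inr 0)).mul (hX (Sum.inl 2))).C_mul _) ?_).sub (e (hX (Sum.inr 2)) ?_)).sub
      (e (((hX (Sum.inr 0)).pow 5).C_mul _) ?_) <;> simp [weightQ12, weightE18, degreesA]
    norm_num
  · refine (e (hX (Sum.inl 1)) ?_).sub (e (hX (Sum.inr 1)) ?_) <;>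
      simp [weightQ12, weightE18, degreesA]

theorem isWeightedHomogeneous_factorsB (c : k) (i : Fin 3) :
    IsWeightedHomogeneous (Sum.elim weightQ12 weightE18) (factorsB c i) (2 * 1 - degreesA i) := by
  have hX := isWeightedHomogeneous_X k (Sum.elim weightQ12 weightE18)
  have e := @isWeightedHomogeneous_of_eq k _ _ (Sum.elim weightQ12 weightE18)
  fin_cases i
  · refine (((((e ((hX (Sum.inl 2)).pow 2) ?_).add (e ((hX (Sum.inl 0)).pow 4) ?_)).add
      (e ((((hX (Sum.inl 0)).pow 3).mul ((hX (Sum.inr 0)).pow 2)).C_mul _) ?_)).add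
      (e ((((hX (Sum.inl 0)).pow 2).mul ((hX (Sum.inr 0)).pow 4)).C_mul _) ?_)).add
      (e (((hX (Sum.inl 0)).mul ((hX (Sum.inr 0)).pow 6)).C_mul _) ?_)).add
      (e (((hX (Sum.inr 0)).pow 8).C_mul _) ?_) <;>
      simp [weightQ12, weightE18, degreesA] <;> norm_num
  · refine ((e (((hX (Sum.inr 0)).mul (hX (Sum.inl 2))).C_mul _) ?_).add (e (hX (Sum.inr 2)) ?_)).add
      (e (((hX (Sum.inr 0)).pow 5).C_mul _) ?_) <;> simp [weightQ12, weightE18, degreesA] <;> norm_num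
  · refine ((e ((hX (Sum.inl 1)).pow 2) ?_).add (e ((hX (Sum.inl 1)).mul (hX (Sum.inr 1))) ?_)).add
      (e ((hX (Sum.inr 1)).pow 2) ?_) <;> simp [weightQ12, weightE18, degreesA] <;> norm_num

/-- The matrix factorization of `u⁵ + v³ + u w² - (x⁵ z + y³ + z²)`. -/
def factorizationQ12E18 [CharZero k] (c : k) (hc : c ^ 10 = -4⁻¹) :
    Defect weightQ12 weightE18 (fQ12 k) (fE18 k) :=
  koszulFactorization (factorsA c) (factorsB c) degreesA 1 (isWeightedHomogeneous_factorsA c)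
    (isWeightedHomogeneous_factorsB c) (sum_factorsA_mul_factorsB c hc)

end Factorization

/-! ### Quantum dimensions -/

section Koszul

variable {T : Type*} [CommRing T]

/-- The supertrace of a product of six differentials of Koszul type of the shape taken by the
partial derivatives of a matrix factorization. -/
theorem supertrace_koszulDifferential (m p e g r s l t q : T) :
    supertrace (koszulDifferential ![1, 0, 0] ![m, 0, 0] *
        (koszulDifferential ![0, 0, 1] ![0, 0, p] * koszulDifferential ![0, e, 0] ![g, e, 0]) *
      (koszulDifferential ![r, s, 0] ![l, t, 0] *
        (koszulDifferential ![0, 0, -1] ![0, 0, q] * koszulDifferential ![0, -1, 0] ![0, 1, 0]))) =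
      (p + q) * (g * (s + t) + 2 * e * (m * r - l)) := by
  -- A product of six odd matrices is even, so only `4 × 4` diagonal blocks remain to be expanded.
  simp only [koszulDifferential, Matrix.fromBlocks_multiply, zero_mul, mul_zero, zero_add,
    add_zero, supertrace, Matrix.toBlocks_fromBlocks₁₁, Matrix.toBlocks_fromBlocks₂₂]
  simp [koszulOddEven, koszulEvenOdd, Matrix.trace, Fin.sum_univ_succ]
  ring

/-- The numerator of the quantum dimensions of a Koszul matrix factorization. -/
theorem qdimNumerator_koszulFactorization {k : Type*} [Field k] {wf wg : Fin 3 → ℚ}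
    {f g : MvPolynomial (Fin 3) k} (a b : Fin 3 → MvPolynomial (Fin 3 ⊕ Fin 3) k) (α : Fin 3 → ℚ)
    (ℓ : ℚ) (ha : ∀ i, IsWeightedHomogeneous (Sum.elim wf wg) (a i) (α i))
    (hb : ∀ i, IsWeightedHomogeneous (Sum.elim wf wg) (b i) (2 * ℓ - α i))
    (hab : ∑ i, a i * b i = difference f g) :
    Defect.qdimNumerator (koszulFactorization a b α ℓ ha hb hab) =
      let K := fun s => koszulDifferential (fun j => pderiv s (a j)) (fun j => pderiv s (b j))
      supertrace (K (Sum.inl 0) * (K (Sum.inl 1) * K (Sum.inl 2)) *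
        (K (Sum.inr 0) * (K (Sum.inr 1) * K (Sum.inr 2)))) := by
  have hd : ∀ s, (koszulDifferential a b).map (pderiv s) =
      koszulDifferential (fun j => pderiv s (a j)) (fun j => pderiv s (b j)) :=
    fun s => koszulDifferential_map (pderiv s).toLinearMap.toAddMonoidHom a b
  have h : Defect.qdimNumerator (koszulFactorization a b α ℓ ha hb hab) =
      supertrace ((List.ofFn fun i => (koszulDifferential a b).map (pderiv (Sum.inl i))).prod *
        (List.ofFn fun i => (koszulDifferential a b).map (pderiv (Sum.inr i))).prod) := rfl
  rw [h]
  simp [List.ofFn_succ, hd]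

end Koszul

section Factorization

variable {k : Type*} [Field k]

/-- The partial derivative of `(u⁵ - c¹⁰ x¹⁰) / (u - c² x²)` with respect to `u`. -/
def pderivU (c : k) : MvPolynomial (Fin 3 ⊕ Fin 3) k :=
  4 * X (Sum.inl 0) ^ 3 + 3 * (C (c ^ 2) * (X (Sum.inl 0) ^ 2 * X (Sum.inr 0) ^ 2)) +
    2 * (C (c ^ 4) * (X (Sum.inl 0) * X (Sum.inr 0) ^ 4)) + C (c ^ 6) * X (Sum.inr 0) ^ 6

/-- The partial derivative of `(u⁵ - c¹⁰ x¹⁰) / (u - c² x²)` with respect to `x`. -/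
def pderivX (c : k) : MvPolynomial (Fin 3 ⊕ Fin 3) k :=
  2 * (C (c ^ 2) * (X (Sum.inl 0) ^ 3 * X (Sum.inr 0))) +
    4 * (C (c ^ 4) * (X (Sum.inl 0) ^ 2 * X (Sum.inr 0) ^ 3)) +
    6 * (C (c ^ 6) * (X (Sum.inl 0) * X (Sum.inr 0) ^ 5)) + 8 * (C (c ^ 8) * X (Sum.inr 0) ^ 7)

theorem pderiv_factorsA_u (c : k) :
    (fun j => pderiv (Sum.inl 0) (factorsA c j)) = ![1, 0, 0] := by
  funext j
  fin_cases j <;> simp [factorsA, pderiv_X]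

theorem pderiv_factorsB_u (c : k) :
    (fun j => pderiv (Sum.inl 0) (factorsB c j)) = ![pderivU c, 0, 0] := by
  funext j
  fin_cases j <;> simp [factorsB, pderiv_X, pderivU]; ring

theorem pderiv_factorsA_v (c : k) :
    (fun j => pderiv (Sum.inl 1) (factorsA c j)) = ![0, 0, 1] := by
  funext j
  fin_cases j <;> simp [factorsA, pderiv_X]

theorem pderiv_factorsB_v (c : k) :
    (fun j => pderiv (Sum.inl 1) (factorsB c j)) = ![0, 0, 2 * X (Sum.inl 1) + X (Sum.inr 1)] := by
  funext j
  fin_cases j <;> simp [factorsB, pderiv_X]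

theorem pderiv_factorsA_w (c : k) :
    (fun j => pderiv (Sum.inl 2) (factorsA c j)) = ![0, C c * X (Sum.inr 0), 0] := by
  funext j
  fin_cases j <;> simp [factorsA, pderiv_X]

theorem pderiv_factorsB_w (c : k) :
    (fun j => pderiv (Sum.inl 2) (factorsB c j)) = 
      ![2 * X (Sum.inl 2), C c * X (Sum.inr 0), 0] := by
  funext j
  fin_cases j <;> simp [factorsB, pderiv_X]

theorem pderiv_factorsA_x (c : k) :
    (fun j => pderiv (Sum.inr 0) (factorsA c j)) = 
      ![-(2 * (C (c ^ 2) * X (Sum.inr 0))), C c * X (Sum.inl 2) - 5 * (C 2⁻¹ * X (Sum.inr 0) ^ 4), 0] := by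
  funext j
  fin_cases j <;> simp [factorsA, pderiv_X] <;> ring

theorem pderiv_factorsB_x (c : k) :
    (fun j => pderiv (Sum.inr 0) (factorsB c j)) = 
      ![pderivX c, C c * X (Sum.inl 2) + 5 * (C 2⁻¹ * X (Sum.inr 0) ^ 4), 0] := by
  funext j
  fin_cases j <;> simp [factorsB, pderiv_X, pderivX] <;> ring

theorem pderiv_factorsA_y (c : k) :
    (fun j => pderiv (Sum.inr 1) (factorsA c j)) = ![0, 0, -1] := by
  funext j
  fin_cases j <;> simp [factorsA, pderiv_X]

theorem pderiv_factorsB_y (c : k) :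
    (fun j => pderiv (Sum.inr 1) (factorsB c j)) = ![0, 0, X (Sum.inl 1) + 2 * X (Sum.inr 1)] := by
  funext j
  fin_cases j <;> simp [factorsB, pderiv_X]

theorem pderiv_factorsA_z (c : k) :
    (fun j => pderiv (Sum.inr 2) (factorsA c j)) = ![0, -1, 0] := by
  funext j
  fin_cases j <;> simp [factorsA, pderiv_X]

theorem pderiv_factorsB_z (c : k) :
    (fun j => pderiv (Sum.inr 2) (factorsB c j)) = ![0, 1, 0] := by
  funext j
  fin_cases j <;> simp [factorsB, pderiv_X]

theorem qdimNumerator_factorizationQ12E18 [CharZero k] (c : k) (hc : c ^ 10 = -4⁻¹) :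
    (factorizationQ12E18 c hc).qdimNumerator =
      C 12 * C c * (X (Sum.inl 1) + X (Sum.inr 1)) * (X (Sum.inl 2) ^ 2 -
        C 5 * (C (c ^ 2) * (X (Sum.inl 0) ^ 3 * X (Sum.inr 0) ^ 2) +
          C (c ^ 4) * (X (Sum.inl 0) ^ 2 * X (Sum.inr 0) ^ 4) +
          C (c ^ 6) * (X (Sum.inl 0) * X (Sum.inr 0) ^ 6) + C (c ^ 8) * X (Sum.inr 0) ^ 8)) := by
  rw [factorizationQ12E18, qdimNumerator_koszulFactorization]
  simp only [pderiv_factorsA_u, pderiv_factorsA_v, pderiv_factorsA_w, pderiv_factorsA_x,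
    pderiv_factorsA_y, pderiv_factorsA_z, pderiv_factorsB_u, pderiv_factorsB_v, pderiv_factorsB_w,
    pderiv_factorsB_x, pderiv_factorsB_y, pderiv_factorsB_z]
  -- Here `p + q = 3 (v + y)`, the `x⁴` terms cancel in `s + t = 2 c w`, and in `m r - l` all four
  -- monomials acquire the numerical factor `-10`.
  rw [supertrace_koszulDifferential, pderivU, pderivX]
  simp only [map_pow, map_ofNat C 12, map_ofNat C 5]
  ring

/-- At `x = y = z = 0` the numerator is `12 c v w²`, and the residue is `-2 c`. -/
theorem leftQdim_factorizationQ12E18_ne_zero [CharZero k] (c : k) (hc : c ^ 10 = -4⁻¹) :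
    (factorizationQ12E18 c hc).leftQdim ≠ 0 := by
  have hc0 : c ≠ 0 := by
    rintro rfl
    norm_num at hc
  refine residue_ne_zero _ _ _ (transformsToPowers_fQ12 k) _ ?_
  -- The exponents `0` and `1` are kept so that `coeff_C_mul_X_pow_three` applies.
  have h : map constantCoeff (sumAlgEquiv k (Fin 3) (Fin 3)
      (factorizationQ12E18 c hc).qdimNumerator) * (transformQ12 k).det =
      C (2 / 5 * c) * (X 0 ^ 0 * X 1 ^ 1 * X 2 ^ 4) +
        C (-2 * c) * (X 0 ^ 4 * X 1 ^ 1 * X 2 ^ 2) := by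
    rw [qdimNumerator_factorizationQ12E18]
    simp [transformQ12,
      Matrix.det_fin_three]
    have h1 : (C 12 * C 5⁻¹ * C 3⁻¹ * C (5 / 2) : MvPolynomial (Fin 3) k) = C 2 := by
      simp only [← C_mul]; exact congrArg C (by norm_num)
    have h2 : (C 12 * C 10⁻¹ * C 3⁻¹ : MvPolynomial (Fin 3) k) = C (2 / 5) := by
      simp only [← C_mul]; exact congrArg C (by norm_num)
    linear_combination C c * X 1 * X 2 ^ 4 * h2 - C c * X 0 ^ 4 * X 1 * X 2 ^ 2 * h1
  rw [h, coeffPred, coeff_add]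
  -- The residue reads off the coefficient of `u⁴ v w²`, which only the second term contributes to.
  have e : (fun i => ![5, 2, 3] i - 1) = ![4, 1, 2] := by decide
  rw [e, coeff_C_mul_X_pow_three, coeff_C_mul_X_pow_three]
  simp [hc0]

/-- At `u = v = w = 0` the numerator is `-60 c⁹ x⁸ y`, and the coefficient of `x⁸ y z` after
multiplication by the determinant is `4 c⁹`. -/
theorem rightQdim_factorizationQ12E18_ne_zero [CharZero k] (c : k) (hc : c ^ 10 = -4⁻¹) :
    (factorizationQ12E18 c hc).rightQdim ≠ 0 := by
  have hc0 : c ≠ 0 := by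
    rintro rfl
    norm_num at hc
  refine residue_ne_zero _ _ _ (transformsToPowers_fE18 k) _ ?_
  have h : map constantCoeff (sumAlgEquiv k (Fin 3) (Fin 3)
      (rename Sum.swap (factorizationQ12E18 c hc).qdimNumerator)) * (transformE18 k).det =
      C (-2 * c ^ 9) * (X 0 ^ 13 * X 1 ^ 1 * X 2 ^ 0) +
        C (4 * c ^ 9) * (X 0 ^ 8 * X 1 ^ 1 * X 2 ^ 1) := by
    rw [qdimNumerator_factorizationQ12E18]
    simp [transformE18,
      Matrix.det_fin_three]
    have h1 : (C 12 * C 5 * C (2 / 5) * C 3⁻¹ * C 2⁻¹ : MvPolynomial (Fin 3) k) = C 4 := by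
      simp only [← C_mul]; exact congrArg C (by norm_num)
    have h2 : (C 12 * C 5 * C 3⁻¹ * C 10⁻¹ : MvPolynomial (Fin 3) k) = C 2 := by
      simp only [← C_mul]; exact congrArg C (by norm_num)
    linear_combination C c ^ 9 * X 0 ^ 8 * X 1 * X 2 * h1 - C c ^ 9 * X 0 ^ 13 * X 1 * h2
  rw [h, coeffPred, coeff_add]
  have e : (fun i => ![9, 2, 2] i - 1) = ![8, 1, 1] := by decide
  rw [e, coeff_C_mul_X_pow_three, coeff_C_mul_X_pow_three]
  simp [hc0]

end Factorization

end LandauGinzburg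

end

theorem mainTheorem2 (k : Type*) [Field k] [IsAlgClosed k] [CharZero k] :
    LandauGinzburg.OrbifoldEquivalent LandauGinzburg.weightQ12 (LandauGinzburg.fQ12 k)
      LandauGinzburg.weightE18 (LandauGinzburg.fE18 k) ∧
    ∃ Q : LandauGinzburg.Defect LandauGinzburg.weightQ12 LandauGinzburg.weightE18
        (LandauGinzburg.fQ12 k) (LandauGinzburg.fE18 k),
      Q.rank = 8 ∧ Q.leftQdim ≠ 0 ∧ Q.rightQdim ≠ 0 := by
  -- Algebraic closedness is needed only for this tenth root.
  obtain ⟨c, hc⟩ := IsAlgClosed.exists_pow_nat_eq (-4⁻¹ : k) (n := 10) (by norm_num)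
  have hl := LandauGinzburg.leftQdim_factorizationQ12E18_ne_zero c hc
  have hr := LandauGinzburg.rightQdim_factorizationQ12E18_ne_zero c hc
  exact ⟨⟨LandauGinzburg.isPotential_fQ12 k, LandauGinzburg.isPotential_fE18 k, _, hl, hr⟩,
    _, rfl, hl, hr⟩
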